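/- Let $\mathbb{T}=\mathbb{R}/\mathbb{Z}$ with its quotient metric $d$ and uniform probability measure $\lambda$. For $r\in[1,\infty]$ and Borel probability measures $\mu,\nu$ on $\mathbb{T}$, let $$W_r^{\mathbb{T}}(\mu,\nu)=\inf_{\pi}\|d\|_{L^r(\pi)},$$ where $\pi$ runs over all probability measures on $\mathbb{T}\times\mathbb{T}$ with marginals $\mu$ and $\nu$. For a prime $p$, let $$\mu_p=\frac1p\sum_{m=1}^{p}\delta_{m^2/p \bmod 1}$$ (points counted with multiplicity). Then: 1. For every $r\in[1,\infty)$ there is a constant $C_r>0$, depending only on $r$, such that $W_r^{\mathbb{T}}(\mu_p,\lambda)\le C_r/\sqrt p$ for all primes $p$. 2. There is a constant $C_\infty>0$ such that $W_\infty^{\mathbb{T}}(\mu_p,\lambda)\le C_\infty\,\log p/\sqrt p$ for all primes $p$. 3. For every odd prime $p$, $$W_2^{\mathbb{T}}(\mu_p,\lambda)=\sqrt{\frac{p^2+p-1}{12p^3}}.$$ 4. Consequently the bound in 1 is tight up to the value of $C_r$ for all $r\in[2,\infty)$: for every odd prime $p$ and every $r\in[2,\infty)$, $W_r^{\mathbb{T}}(\mu_p,\lambda)\ge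 1/\sqrt{12p}$. -/

import Mathlib

open MeasureTheory
open scoped ENNReal

noncomputable section

/-- The couplings of `μ` and `ν`: probability measures on `X × X` with marginals `μ` and `ν`. -/
def couplings {X : Type*} [MeasurableSpace X] (μ ν : Measure X) : Set (Measure (X × X)) :=
  {π | IsProbabilityMeasure π ∧ π.fst = μ ∧ π.snd = ν}

/-- The Wasserstein distance of exponent `r ∈ [1, ∞]` on a metric space:
the infimum over all couplings `π` of the `L^r(π)` norm of the metric (for `r = ∞`, the
essential supremum). -/
def wasserstein {X : Type*} [PseudoMetricSpace X] [MeasurableSpace X]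
    (r : ℝ≥0∞) (μ ν : Measure X) : ℝ≥0∞ :=
  ⨅ π ∈ couplings μ ν, eLpNorm (fun z : X × X => dist z.1 z.2) r π

/-- The empirical measure `(1/N) ∑_{n=1}^N δ_{x n}`, in which repeated points are counted with
multiplicity. -/
def empiricalMeasure {X : Type*} [MeasurableSpace X] (x : ℕ → X) (N : ℕ) : Measure X :=
  (N : ℝ≥0∞)⁻¹ • ∑ n ∈ Finset.Icc 1 N, Measure.dirac (x n)

/-- The empirical measure on `ℝ/ℤ` of the points `m² / p mod 1`, `1 ≤ m ≤ p`. -/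
def quadraticResidueMeasure (p : ℕ) : Measure UnitAddCircle :=
  empiricalMeasure (fun m : ℕ => (((m : ℝ) ^ 2 / (p : ℝ) : ℝ) : UnitAddCircle)) p

end

/-! ### Functions on `ZMod p` with a prescribed difference -/

/-! Let `χ` be the quadratic character mod an odd prime `p`. The measure gives `k/p` mass `(1 + χ
k)/p`, because `k` has `1 + χ k` square roots. Let `s` be the mean-zero function on `ZMod p` with
difference `χ`. The arcs between consecutive points `(k - 1/2 + s k)/p` have exactly these masses as
lengths, and sending the `k`-th arc to `k/p` is a coupling whose displacement is `O((|s k| + |s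
(k+1)| + 1)/p)`. All upper bounds are therefore bounds on `s`.

For exponent 2 the cost is an affine function of `∑ s²`, which is exact because distinct shifts of
`χ` have correlation `-1`. Optimality is Kantorovich duality: a potential with difference `-(2/p²)
s(z+1)` closes up around the circle precisely because `s` has mean zero, and it satisfies
complementary slackness with the arcs.

For the other exponents, the Gauss sum bounds the `k`-th Fourier coefficient of `s` by `√p/(4|k|)`.
A dyadic block of frequencies is then at most `√p` in sup norm, with `L²` energy decaying like
`2^(-j)`. Interpolation makes the `L^n` norms of the blocks a geometric series, so the `L^n` average
of `s` is `O(√p)`; in sup norm the `O(log p)` blocks merely add up, which gives the logarithm. -/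

theorem ZMod.sum_eq_sum_range {A : Type*} [AddCommMonoid A] (n : ℕ) [NeZero n] (f : ZMod n → A) :
    ∑ z, f z = ∑ i ∈ Finset.range n, f (i : ZMod n) := by
  symm
  refine Finset.sum_bij' (fun i _ => (i : ZMod n)) (fun z _ => z.val) (by simp)
    (fun z _ => by simpa using z.val_lt) (fun i hi => ?_) (fun z _ => by simp) (fun i _ => rfl)
  exact ZMod.val_cast_of_lt (by simpa using hi)

/-- Summation from `0` gives an antiderivative; the vanishing total is what makes it consistent at
the wrap-around `n - 1 → 0`. -/
theorem ZMod.exists_forall_add_one_sub {A : Type*} [AddCommGroup A] {n : ℕ} [NeZero n]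
    [Fact (1 < n)] (f : ZMod n → A) (hf : ∑ z, f z = 0) :
    ∃ F : ZMod n → A, ∀ z, F (z + 1) - F z = f z := by
  refine ⟨fun z => ∑ i ∈ Finset.range z.val, f i, fun z => ?_⟩
  rcases lt_or_ge (z.val + 1) n with h | h
  · have : (z + 1).val = z.val + 1 := by
      rw [ZMod.val_add_of_lt] <;> rw [ZMod.val_one] ; exact h
    simp only [this, Finset.sum_range_succ]
    simp
  · have h1 : z.val + 1 = n := le_antisymm z.val_lt h
    have h2 : z + 1 = 0 := by
      have : ((z.val + 1 : ℕ) : ZMod n) = 0 := by rw [h1]; simp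
      simpa using this
    have h3 : ∑ z, f z = ∑ i ∈ Finset.range (z.val + 1), f i := by
      rw [ZMod.sum_eq_sum_range, h1]
    rw [Finset.sum_range_succ, hf] at h3
    simp only [h2, ZMod.val_zero, Finset.range_zero, Finset.sum_empty, zero_sub]
    rw [neg_eq_iff_add_eq_zero, add_comm, h3]
    simp [add_comm]

theorem ZMod.eq_of_forall_add_one_sub_eq {A : Type*} [AddCommGroup A] {n : ℕ} [NeZero n]
    {F G : ZMod n → A} (h : ∀ z, F (z + 1) - F z = G (z + 1) - G z) (z : ZMod n) :
    F z - G z = F 0 - G 0 := by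
  have key : ∀ i : ℕ, F (i : ZMod n) - G i = F 0 - G 0 := by
    intro i
    induction i with
    | zero => simp
    | succ i ih =>
      rw [← ih, Nat.cast_succ, sub_eq_sub_iff_sub_eq_sub, h]
  simpa using key z.val

/-! ### The variance of the partial sums of the quadratic character -/

section QuadraticChar

variable {p : ℕ} [Fact p.Prime]

/-- The substitution `z = -c x` turns the correlation into `χ(-1)` times the Jacobi sum `J(χ, χ⁻¹) =
-χ(-1)`. -/
theorem sum_quadraticChar_mul_add (hp : p ≠ 2) {c : ZMod p} (hc : c ≠ 0) :
    ∑ z, quadraticChar (ZMod p) z * quadraticChar (ZMod p) (z + c) = -1 := by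
  have hp' : ringChar (ZMod p) ≠ 2 := by rwa [ZMod.ringChar_zmod_n]
  have hJ := jacobiSum_nontrivial_inv (quadraticChar_ne_one hp')
  rw [(quadraticChar_isQuadratic (ZMod p)).inv, jacobiSum] at hJ
  have hsq {a : ZMod p} (ha : a ≠ 0) : quadraticChar (ZMod p) a * quadraticChar (ZMod p) a = 1 := by
    rw [← sq]; exact quadraticChar_sq_one ha
  have h1 : ∑ x : ZMod p, quadraticChar (ZMod p) x * quadraticChar (ZMod p) (1 - x) =
      ∑ z, quadraticChar (ZMod p) (-1) *
        (quadraticChar (ZMod p) z * quadraticChar (ZMod p) (z + c)) := by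
    refine (Fintype.sum_bijective (fun x => -c * x)
      (mulLeft_bijective₀ _ (neg_ne_zero.2 hc)) _ _ fun x => ?_)
    rw [show -c * x + c = c * (1 - x) by ring, show -c * x = -1 * (c * x) by ring]
    simp only [map_mul]
    have h2 := hsq hc
    have h3 := hsq (a := (-1 : ZMod p)) (by simp)
    linear_combination (-(quadraticChar (ZMod p) (-1) * quadraticChar (ZMod p) (-1)) *
      quadraticChar (ZMod p) x * quadraticChar (ZMod p) (1 - x)) * h2 -
      quadraticChar (ZMod p) x * quadraticChar (ZMod p) (1 - x) * h3
  rw [h1, ← Finset.mul_sum] at hJ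
  have h3 := hsq (a := (-1 : ZMod p)) (by simp)
  linear_combination quadraticChar (ZMod p) (-1) * hJ -
    (∑ z, quadraticChar (ZMod p) z * quadraticChar (ZMod p) (z + c) + 1) * h3

theorem sum_quadraticChar_add_mul_add (hp : p ≠ 2) (a b : ZMod p) :
    ∑ z, quadraticChar (ZMod p) (z + a) * quadraticChar (ZMod p) (z + b) =
      (if a = b then (p : ℤ) else 0) - 1 := by
  have h1 : ∑ z, quadraticChar (ZMod p) (z + a) * quadraticChar (ZMod p) (z + b) =
      ∑ z, quadraticChar (ZMod p) z * quadraticChar (ZMod p) (z + (b - a)) :=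
    Fintype.sum_bijective (fun z => z + a) (AddGroup.addRight_bijective a) _ _ fun z => by
      ring_nf
  rw [h1]
  split_ifs with h
  · subst h
    have : ∀ z : ZMod p, quadraticChar (ZMod p) z * quadraticChar (ZMod p) (z + (a - a)) =
        1 - if z = 0 then 1 else 0 := by
      intro z
      split_ifs with hz
      · simp [hz]
      · rw [sub_self, add_zero, ← sq, quadraticChar_sq_one hz, sub_zero]
    rw [Finset.sum_congr rfl fun z _ => this z]
    simp [Finset.sum_sub_distrib, ZMod.card]
  · rw [sum_quadraticChar_mul_add hp (sub_ne_zero.2 (Ne.symm h)), zero_sub]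

variable {s : ZMod p → ℝ} (hs : ∀ z, s (z + 1) - s z = quadraticChar (ZMod p) z)

include hs

theorem add_natCast_sub_eq_sum_quadraticChar (h : ℕ) (z : ZMod p) :
    s (z + h) - s z = ∑ a ∈ Finset.range h, (quadraticChar (ZMod p) (z + a) : ℝ) := by
  induction h with
  | zero => simp
  | succ h ih => rw [Finset.sum_range_succ, ← ih, ← hs]; push_cast; ring_nf

/-- The increment is a sum of `χ` over a window of length `h`. Expanding the square gives `h²`
correlations, each contributing `-1`, and the `h` diagonal ones an extra `p`; `h ≤ p` keeps the
shifts distinct. -/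
theorem sum_sq_add_natCast_sub (hp : p ≠ 2) {h : ℕ} (hh : h ≤ p) :
    ∑ z, (s (z + h) - s z) ^ 2 = h * (p - h) := by
  have h1 : ∀ a ∈ Finset.range h, ∀ b ∈ Finset.range h,
      ∑ z : ZMod p, (quadraticChar (ZMod p) (z + a) : ℝ) * (quadraticChar (ZMod p) (z + b) : ℝ) =
      (if a = b then (p : ℝ) else 0) - 1 := by
    intro a ha b hb
    have h2 := sum_quadraticChar_add_mul_add hp (a : ZMod p) (b : ZMod p)
    have h3 : ((a : ZMod p) = b) ↔ a = b := by
      rw [ZMod.natCast_eq_natCast_iff']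
      rw [Nat.mod_eq_of_lt (by simp at ha; lia), Nat.mod_eq_of_lt (by simp at hb; lia)]
    simp only [h3] at h2
    exact_mod_cast h2
  calc ∑ z, (s (z + h) - s z) ^ 2
      = ∑ z : ZMod p, ∑ a ∈ Finset.range h, ∑ b ∈ Finset.range h,
        (quadraticChar (ZMod p) (z + a) : ℝ) * (quadraticChar (ZMod p) (z + b) : ℝ) := by
        refine Finset.sum_congr rfl fun z _ => ?_
        rw [add_natCast_sub_eq_sum_quadraticChar hs, sq, Finset.sum_mul_sum]
    _ = ∑ a ∈ Finset.range h, ∑ b ∈ Finset.range h, ((if a = b then (p : ℝ) else 0) - 1) := by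
        rw [Finset.sum_comm]
        refine Finset.sum_congr rfl fun a ha => ?_
        rw [Finset.sum_comm]
        exact Finset.sum_congr rfl fun b hb => h1 a ha b hb
    _ = ∑ a ∈ Finset.range h, ((p : ℝ) - h) := by
        refine Finset.sum_congr rfl fun a ha => ?_
        rw [Finset.sum_sub_distrib, Finset.sum_ite_eq, if_pos ha]
        simp
    _ = h * (p - h) := by rw [Finset.sum_const, Finset.card_range, nsmul_eq_mul]

/-- For mean-zero `s`, summing squared increments over all shifts gives `2p ∑ s²`, the cross terms
vanishing; the increments are known, so it remains to sum `h(p - h)`. -/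
theorem sum_sq_of_sum_eq_zero (hp : p ≠ 2) (hs0 : ∑ z, s z = 0) :
    ∑ z, s z ^ 2 = ((p : ℝ) ^ 2 - 1) / 12 := by
  have h1 : ∑ h ∈ Finset.range p, ∑ z, (s (z + h) - s z) ^ 2 = 2 * p * ∑ z, s z ^ 2 := by
    rw [← ZMod.sum_eq_sum_range p (fun w => ∑ z, (s (z + w) - s z) ^ 2), Finset.sum_comm]
    have : ∀ z, ∑ w, (s (z + w) - s z) ^ 2 = ∑ w, s w ^ 2 + p * s z ^ 2 := by
      intro z
      rw [Fintype.sum_bijective (fun w => z + w) (AddGroup.addLeft_bijective z) _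
        (fun w => (s w - s z) ^ 2) fun w => rfl]
      simp only [sub_sq, Finset.sum_add_distrib, Finset.sum_sub_distrib, ← Finset.sum_mul,
        ← Finset.mul_sum, hs0]
      simp [ZMod.card]
    simp only [this, Finset.sum_add_distrib, ← Finset.mul_sum]
    simp [ZMod.card]
    ring
  have h2 : ∀ n : ℕ, ∑ h ∈ Finset.range n, (h : ℝ) * (p - h) =
      p * (n * (n - 1) / 2) - (n - 1) * n * (2 * n - 1) / 6 := by
    intro n
    induction n with
    | zero => simp
    | succ n ih => rw [Finset.sum_range_succ, ih]; push_cast; ring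
  rw [Finset.sum_congr rfl fun h hh =>
    sum_sq_add_natCast_sub hs hp (Finset.mem_range.1 hh).le, h2] at h1
  have hp0 : (p : ℝ) ≠ 0 := by exact_mod_cast (Fact.out : p.Prime).ne_zero
  apply mul_left_cancel₀ (mul_ne_zero two_ne_zero hp0)
  rw [← h1]
  ring

end QuadraticChar

/-! ### Fourier expansion of the partial sums of the quadratic character -/

section Fourier

/-- Here `|e^{iθ} - 1| = 2|sin(θ/2)|`, and the least absolute representative keeps `|θ/2| ≤ π/2`,
where Jordan's inequality applies. -/
theorem ZMod.norm_stdAddChar_sub_one_ge {n : ℕ} [NeZero n] (k : ZMod n) :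
    4 * (k.valMinAbs.natAbs : ℝ) / n ≤ ‖ZMod.stdAddChar k - 1‖ := by
  have hn : (0 : ℝ) < n := by exact_mod_cast NeZero.pos n
  have h1 : ZMod.stdAddChar k =
      Complex.exp (Complex.I * ((2 * Real.pi * k.valMinAbs / n : ℝ) : ℂ)) := by
    conv_lhs => rw [← ZMod.coe_valMinAbs k]
    rw [ZMod.stdAddChar_coe]
    congr 1
    push_cast
    ring
  have h2 : (k.valMinAbs.natAbs : ℝ) = |(k.valMinAbs : ℝ)| := by
    rw [Nat.cast_natAbs, Int.cast_abs]
  have h3 : (k.valMinAbs.natAbs : ℝ) ≤ n / 2 := by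
    refine (Nat.cast_le.2 (ZMod.natAbs_valMinAbs_le k)).trans ?_
    exact Nat.cast_div_le
  rw [h2] at h3
  rw [h1, Complex.norm_exp_I_mul_ofReal_sub_one, norm_mul, Real.norm_eq_abs, Real.norm_eq_abs,
    Real.abs_sin_eq_sin_abs_of_abs_le_pi, abs_two, h2]
  · have h4 : |2 * Real.pi * (k.valMinAbs : ℝ) / n / 2| = Real.pi * |(k.valMinAbs : ℝ)| / n := by
      rw [show 2 * Real.pi * (k.valMinAbs : ℝ) / n / 2 = Real.pi * k.valMinAbs / n by ring,
        abs_div, abs_mul, abs_of_pos Real.pi_pos, abs_of_pos hn]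
    have h5 : Real.pi * |(k.valMinAbs : ℝ)| / n ≤ Real.pi / 2 := by
      rw [div_le_iff₀ hn]
      nlinarith [Real.pi_pos]
    have h6 := Real.mul_le_sin (x := Real.pi * |(k.valMinAbs : ℝ)| / n) (by positivity) h5
    rw [h4]
    calc 4 * |(k.valMinAbs : ℝ)| / n = 2 * (2 / Real.pi * (Real.pi * |(k.valMinAbs : ℝ)| / n)) := by
          field_simp; ring
      _ ≤ _ := by gcongr
  · rw [show 2 * Real.pi * (k.valMinAbs : ℝ) / n / 2 = Real.pi * k.valMinAbs / n by ring,
        abs_div, abs_mul, abs_of_pos Real.pi_pos, abs_of_pos hn, div_le_iff₀ hn]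
    nlinarith [Real.pi_pos]

theorem ZMod.sum_norm_sq_sum_stdAddChar {n : ℕ} [NeZero n] (a : ZMod n → ℂ) :
    ∑ z, ‖∑ k, a k * ZMod.stdAddChar (k * z)‖ ^ 2 = n * ∑ k, ‖a k‖ ^ 2 := by
  have h1 : ∀ k l : ZMod n, ∑ z : ZMod n, ZMod.stdAddChar (k * z) *
      (starRingEnd ℂ) (ZMod.stdAddChar (l * z)) = if k = l then (n : ℂ) else 0 := by
    intro k l
    have h2 := AddChar.sum_mulShift (k - l) (ZMod.isPrimitive_stdAddChar n)
    rw [ZMod.card] at h2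
    simp only [sub_eq_zero] at h2
    have h3 : ((if k = l then n else 0 : ℕ) : ℂ) = if k = l then (n : ℂ) else 0 := by
      split_ifs <;> simp
    rw [h3] at h2
    rw [← h2]
    refine Finset.sum_congr rfl fun z _ => ?_
    rw [← AddChar.map_neg_eq_conj, ← AddChar.map_add_eq_mul]
    ring_nf
  have h4 : ((∑ z, ‖∑ k, a k * ZMod.stdAddChar (k * z)‖ ^ 2 : ℝ) : ℂ) =
      ((n * ∑ k, ‖a k‖ ^ 2 : ℝ) : ℂ) := by
    push_cast
    calc _ = ∑ z, ∑ k, ∑ l, a k * (starRingEnd ℂ) (a l) * (ZMod.stdAddChar (k * z) *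
          (starRingEnd ℂ) (ZMod.stdAddChar (l * z))) := by
          refine Finset.sum_congr rfl fun z _ => ?_
          rw [← Complex.mul_conj', map_sum, Finset.sum_mul_sum]
          refine Finset.sum_congr rfl fun k _ => Finset.sum_congr rfl fun l _ => ?_
          rw [map_mul (starRingEnd ℂ)]
          ring
      _ = ∑ k, ∑ l, a k * (starRingEnd ℂ) (a l) * if k = l then (n : ℂ) else 0 := by
          rw [Finset.sum_comm]
          refine Finset.sum_congr rfl fun k _ => ?_
          rw [Finset.sum_comm]
          refine Finset.sum_congr rfl fun l _ => ?_
          rw [← Finset.mul_sum, h1]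
      _ = _ := by
          simp only [mul_ite, mul_zero, Finset.sum_ite_eq, Finset.mem_univ, if_true,
            Complex.mul_conj']
          rw [← Finset.sum_mul, mul_comm]
  exact_mod_cast h4

variable {p : ℕ} [Fact p.Prime]

theorem exists_gauss (hp : p ≠ 2) : ∃ G : ℂ, ‖G‖ = √p ∧ ∀ z : ZMod p,
    ∑ k, (quadraticChar (ZMod p) k : ℂ) * ZMod.stdAddChar (k * z) = quadraticChar (ZMod p) z * G := by
  have hp' : ringChar (ZMod p) ≠ 2 := by rwa [ZMod.ringChar_zmod_n]
  set χ : MulChar (ZMod p) ℂ := (quadraticChar (ZMod p)).ringHomComp (Int.castRingHom ℂ) with hχ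
  have hχ1 : χ ≠ 1 := by
    rw [hχ, MulChar.ringHomComp_ne_one_iff]
    · exact quadraticChar_ne_one hp'
    · exact Int.cast_injective
  have hχ2 : χ.IsQuadratic := (quadraticChar_isQuadratic _).comp _
  have happ : ∀ k, χ k = (quadraticChar (ZMod p) k : ℂ) := fun k => rfl
  refine ⟨gaussSum χ ZMod.stdAddChar, ?_, fun z => ?_⟩
  · have h1 := gaussSum_sq hχ1 hχ2 (ZMod.isPrimitive_stdAddChar p)
    have h2 := congrArg norm h1
    rw [norm_pow, norm_mul, happ, ZMod.card] at h2
    have h3 : ‖(quadraticChar (ZMod p) (-1) : ℂ)‖ = 1 := by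
      rcases quadraticChar_dichotomy (F := ZMod p) (a := -1) (by simp) with h | h <;> simp only [h] <;> simp
    rw [h3, one_mul, Complex.norm_natCast] at h2
    rw [← h2, Real.sqrt_sq (norm_nonneg _)]
  · by_cases hz : z = 0
    · subst hz
      have := quadraticChar_sum_zero hp'
      simp only [mul_zero, AddChar.map_zero_eq_one, mul_one, MulChar.map_zero, Int.cast_zero, zero_mul]
      exact_mod_cast this
    · have h1 := gaussSum_mulShift χ ZMod.stdAddChar (Units.mk0 z hz)
      simp only [gaussSum, AddChar.mulShift_apply, Units.val_mk0, happ] at h1 ⊢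
      rw [← h1, ← mul_assoc, ← Int.cast_mul, ← sq, quadraticChar_sq_one hz, Int.cast_one, one_mul]
      exact Finset.sum_congr rfl fun k _ => by rw [mul_comm k z]

/-- The partial sums of the quadratic character, normalised to have mean zero, have Fourier
coefficients of size `O(√p / |k|)`. -/
theorem exists_fourier_coefficients (hp : p ≠ 2) {s : ZMod p → ℝ}
    (hs : ∀ z, s (z + 1) - s z = quadraticChar (ZMod p) z) (hs0 : ∑ z, s z = 0) :
    ∃ a : ZMod p → ℂ, a 0 = 0 ∧ (∀ k, ‖a k‖ ≤ √p / (4 * k.valMinAbs.natAbs)) ∧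
      ∀ z, (s z : ℂ) = ∑ k, a k * ZMod.stdAddChar (k * z) := by
  obtain ⟨G, hG, hGs⟩ := exists_gauss hp
  have hp0 : (0 : ℝ) < p := by exact_mod_cast (Fact.out : p.Prime).pos
  have hG0 : G ≠ 0 := by
    rw [← norm_ne_zero_iff, hG]
    positivity
  -- Differencing multiplies the `k`-th coefficient by `stdAddChar k - 1`, and `χ` itself has
  -- coefficients `χ k / G`.
  set a : ZMod p → ℂ := fun k => quadraticChar (ZMod p) k / (G * (ZMod.stdAddChar k - 1)) with ha
  have ha0 : a 0 = 0 := by simp [ha]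
  refine ⟨a, ha0, fun k => ?_, fun z => ?_⟩
  · by_cases hk : k = 0
    · subst hk
      rw [ha0]
      simp
    have h1 : ‖(quadraticChar (ZMod p) k : ℂ)‖ = 1 := by
      rcases quadraticChar_dichotomy hk with h | h <;> simp only [h] <;> simp
    have h2 : 0 < (k.valMinAbs.natAbs : ℝ) := by
      have : k.valMinAbs ≠ 0 := by rwa [Ne, ZMod.valMinAbs_eq_zero]
      exact_mod_cast Int.natAbs_pos.2 this
    have h3 := ZMod.norm_stdAddChar_sub_one_ge k
    rw [ha, norm_div, h1, norm_mul, hG]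
    calc 1 / (√p * ‖ZMod.stdAddChar k - 1‖)
        ≤ 1 / (√p * (4 * (k.valMinAbs.natAbs : ℝ) / p)) := by gcongr
      _ = (√p * √p) / (√p * (4 * (k.valMinAbs.natAbs : ℝ))) := by
        rw [Real.mul_self_sqrt hp0.le]
        field_simp
      _ = _ := mul_div_mul_left _ _ (by positivity)
  · set g : ZMod p → ℂ := fun z => ∑ k, a k * ZMod.stdAddChar (k * z) with hg
    have hdiff : ∀ z, g (z + 1) - g z = quadraticChar (ZMod p) z := by
      intro z
      rw [hg]
      simp only [← Finset.sum_sub_distrib]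
      rw [← mul_div_cancel_right₀ (quadraticChar (ZMod p) z : ℂ) hG0, ← hGs, Finset.sum_div]
      refine Finset.sum_congr rfl fun k _ => ?_
      by_cases hk : k = 0
      · simp [hk, ha0]
      have : ZMod.stdAddChar k - 1 ≠ 0 := by
        rw [sub_ne_zero]
        intro h
        rw [← AddChar.map_zero_eq_one (ZMod.stdAddChar (N := p)),
          ZMod.injective_stdAddChar.eq_iff] at h
        exact hk h
      rw [mul_add, mul_one, AddChar.map_add_eq_mul]
      simp only [ha]
      field_simp
    have hg0 : ∑ z, g z = 0 := by
      rw [hg, Finset.sum_comm]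
      refine Finset.sum_eq_zero fun k _ => ?_
      rw [← Finset.mul_sum]
      by_cases hk : k = 0
      · simp [hk, ha0]
      have := AddChar.sum_mulShift k (ZMod.isPrimitive_stdAddChar p)
      rw [if_neg hk, Nat.cast_zero] at this
      rw [Finset.sum_congr rfl fun z _ => by rw [mul_comm k z], this, mul_zero]
    have hconst := ZMod.eq_of_forall_add_one_sub_eq (F := fun z => (s z : ℂ)) (G := g) fun z => by
      rw [hdiff z, ← Complex.ofReal_sub, hs z]
      simp
    have h0 : ∑ z, ((s z : ℂ) - g z) = 0 := by
      rw [Finset.sum_sub_distrib, hg0, ← Complex.ofReal_sum, hs0]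
      simp
    rw [Finset.sum_congr rfl fun z _ => hconst z, Finset.sum_const, Finset.card_univ, ZMod.card,
      nsmul_eq_mul, mul_eq_zero] at h0
    have hpc : (p : ℂ) ≠ 0 := by exact_mod_cast hp0.ne'
    have := hconst z
    rw [h0.resolve_left hpc, sub_eq_zero] at this
    exact this

end Fourier

/-! ### Moments of the partial sums of the quadratic character -/

section Moments

theorem ZMod.card_log_natAbs_valMinAbs_le (n j : ℕ) [NeZero n] :
    (Finset.univ.filter fun k : ZMod n => Nat.log 2 k.valMinAbs.natAbs = j).card ≤ 4 * 2 ^ j := by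
  have h1 : (Finset.univ.filter fun k : ZMod n => Nat.log 2 k.valMinAbs.natAbs = j).card ≤
      (Finset.Ioo (-(2 ^ (j + 1) : ℤ)) (2 ^ (j + 1))).card := by
    refine Finset.card_le_card_of_injOn ZMod.valMinAbs (fun k hk => ?_)
      ZMod.injective_valMinAbs.injOn
    have h2 : Nat.log 2 k.valMinAbs.natAbs = j := by simpa using hk
    have h3 : k.valMinAbs.natAbs < 2 ^ (j + 1) := by
      rw [← h2]
      exact Nat.lt_pow_succ_log_self one_lt_two _
    have h4 : (k.valMinAbs.natAbs : ℤ) < 2 ^ (j + 1) := by exact_mod_cast h3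
    rw [Int.natCast_natAbs, abs_lt] at h4
    simpa using h4
  refine h1.trans ?_
  rw [Int.card_Ioo, pow_succ]
  have : ((2 : ℤ) ^ j) = ((2 ^ j : ℕ) : ℤ) := by simp
  rw [this]
  lia

variable {p : ℕ} [Fact p.Prime]

/-- A decomposition of the partial sums of the quadratic character into dyadic frequency blocks. -/
theorem exists_dyadic_decomposition (hp : p ≠ 2) {s : ZMod p → ℝ}
    (hs : ∀ z, s (z + 1) - s z = quadraticChar (ZMod p) z) (hs0 : ∑ z, s z = 0) :
    ∃ f : ℕ → ZMod p → ℂ, (∀ z, (s z : ℂ) = ∑ j ∈ Finset.range (Nat.log 2 p + 1), f j z) ∧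
      (∀ j z, ‖f j z‖ ≤ √p) ∧ ∀ j, ∑ z, ‖f j z‖ ^ 2 ≤ (p : ℝ) ^ 2 * (1 / 2) ^ j := by
  obtain ⟨a, ha0, ha, hsa⟩ := exists_fourier_coefficients hp hs hs0
  -- Since `Nat.log 2 0 = 0`, frequency `0` falls into block `0`; this is harmless as `a 0 = 0`.
  set B : ℕ → Finset (ZMod p) := fun j =>
    Finset.univ.filter fun k : ZMod p => Nat.log 2 k.valMinAbs.natAbs = j with hB
  have haB : ∀ j, ∀ k ∈ B j, ‖a k‖ ≤ √p / (4 * 2 ^ j) := by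
    intro j k hk
    by_cases hk0 : k = 0
    · rw [hk0, ha0, norm_zero]
      positivity
    refine (ha k).trans ?_
    have h1 : k.valMinAbs.natAbs ≠ 0 := by
      rwa [Ne, Int.natAbs_eq_zero, ZMod.valMinAbs_eq_zero]
    have h2 : 2 ^ j ≤ k.valMinAbs.natAbs := by
      rw [← (Finset.mem_filter.1 hk).2]
      exact Nat.pow_log_le_self 2 h1
    have h3 : (2 : ℝ) ^ j ≤ k.valMinAbs.natAbs := by exact_mod_cast h2
    gcongr
  have hcard : ∀ j, ((B j).card : ℝ) ≤ 4 * 2 ^ j := fun j => by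
    exact_mod_cast ZMod.card_log_natAbs_valMinAbs_le p j
  refine ⟨fun j z => ∑ k ∈ B j, a k * ZMod.stdAddChar (k * z), fun z => ?_, fun j z => ?_,
    fun j => ?_⟩
  · rw [hsa z]
    refine (Finset.sum_fiberwise_of_maps_to (fun k _ => ?_) _).symm
    rw [Finset.mem_range, Nat.lt_succ_iff]
    exact Nat.log_mono_right ((ZMod.natAbs_valMinAbs_le k).trans (Nat.div_le_self _ _))
  · calc ‖∑ k ∈ B j, a k * ZMod.stdAddChar (k * z)‖ ≤ ∑ k ∈ B j, √p / (4 * 2 ^ j) := by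
          refine norm_sum_le_of_le _ fun k hk => ?_
          rw [norm_mul, ZMod.stdAddChar_apply, Circle.norm_coe, mul_one]
          exact haB j k hk
      _ = (B j).card * (√p / (4 * 2 ^ j)) := by rw [Finset.sum_const, nsmul_eq_mul]
      _ ≤ 4 * 2 ^ j * (√p / (4 * 2 ^ j)) := by gcongr; exact hcard j
      _ = √p := mul_div_cancel₀ _ (by positivity)
  · have h1 := ZMod.sum_norm_sq_sum_stdAddChar (fun k => if k ∈ B j then a k else 0)
    simp only [ite_mul, zero_mul, Finset.sum_ite_mem, Finset.univ_inter] at h1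
    rw [h1]
    calc (p : ℝ) * ∑ k, ‖if k ∈ B j then a k else 0‖ ^ 2
        = p * ∑ k ∈ B j, ‖a k‖ ^ 2 := by
          rw [← Finset.univ_inter (B j), ← Finset.sum_ite_mem, Finset.univ_inter]
          congr 1
          refine Finset.sum_congr rfl fun k _ => ?_
          split_ifs <;> simp
      _ ≤ p * ∑ k ∈ B j, (√p / (4 * 2 ^ j)) ^ 2 := by
          gcongr with k hk
          exact haB j k hk
      _ = p * ((B j).card * (√p / (4 * 2 ^ j)) ^ 2) := by rw [Finset.sum_const, nsmul_eq_mul]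
      _ ≤ p * (4 * 2 ^ j * (√p / (4 * 2 ^ j)) ^ 2) := by gcongr; exact hcard j
      _ = (p : ℝ) ^ 2 * (1 / 2) ^ j / 4 := by
          rw [div_pow, Real.sq_sqrt (Nat.cast_nonneg p), one_div, inv_pow]
          field_simp
      _ ≤ _ := div_le_self (by positivity) (by norm_num)

theorem abs_le_sqrt_mul_log (hp : p ≠ 2) {s : ZMod p → ℝ}
    (hs : ∀ z, s (z + 1) - s z = quadraticChar (ZMod p) z) (hs0 : ∑ z, s z = 0) (z : ZMod p) :
    |s z| ≤ 2 / Real.log 2 * (√p * Real.log p) := by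
  obtain ⟨f, hf, hf1, -⟩ := exists_dyadic_decomposition hp hs hs0
  have h2 : 2 ≤ p := (Fact.out : p.Prime).two_le
  have hlog : 0 < Real.log 2 := Real.log_pos one_lt_two
  have h3 : Real.log 2 ≤ Real.log p := Real.log_le_log two_pos (by exact_mod_cast h2)
  have h4 : (Nat.log 2 p : ℝ) ≤ Real.log p / Real.log 2 := by
    rw [le_div_iff₀ hlog, ← Real.log_pow]
    refine Real.log_le_log (by positivity) ?_
    exact_mod_cast Nat.pow_log_le_self 2 (by lia)
  have h5 : 1 ≤ Real.log p / Real.log 2 := (one_le_div hlog).2 h3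
  calc |s z| = ‖(s z : ℂ)‖ := by rw [Complex.norm_real, Real.norm_eq_abs]
    _ ≤ ∑ j ∈ Finset.range (Nat.log 2 p + 1), √p := by
        rw [hf z]
        exact norm_sum_le_of_le _ fun j _ => hf1 j z
    _ = (Nat.log 2 p + 1) * √p := by simp
    _ ≤ (Real.log p / Real.log 2 + Real.log p / Real.log 2) * √p := by gcongr
    _ = _ := by ring

/-- Interpolating the sup and `L²` bounds of each dyadic block gives geometric decay in `L^n`, and
Minkowski's inequality sums the blocks. -/
theorem exists_moment_bound {n : ℕ} (hn : 2 ≤ n) : ∃ K : ℝ, 0 < K ∧ ∀ {p : ℕ} [Fact p.Prime],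
    p ≠ 2 → ∀ {s : ZMod p → ℝ}, (∀ z, s (z + 1) - s z = quadraticChar (ZMod p) z) →
      ∑ z, s z = 0 → ∑ z, |s z| ^ n ≤ p * (K * √p) ^ n := by
  have hn0 : (n : ℝ) ≠ 0 := by positivity
  -- The `n`-th root of the energy decay rate: a block has `L^n` norm at most `p^(1/n) √p q^j`.
  set q : ℝ := (1 / 2 : ℝ) ^ (1 / n : ℝ) with hq
  have hq0 : 0 < q := by positivity
  have hq1 : q < 1 := Real.rpow_lt_one (by norm_num) (by norm_num) (by positivity)
  have hqn : q ^ n = 1 / 2 := by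
    rw [hq, one_div (n : ℝ), Real.rpow_inv_natCast_pow (by norm_num) (by lia)]
  have hK : 0 < (1 - q)⁻¹ := inv_pos.2 (sub_pos.2 hq1)
  refine ⟨(1 - q)⁻¹, hK, fun {p} _ hp {s} hs hs0 => ?_⟩
  obtain ⟨f, hf, hf1, hf2⟩ := exists_dyadic_decomposition hp hs hs0
  have hp0 : (0 : ℝ) < p := by exact_mod_cast (Fact.out : p.Prime).pos
  have : Fact (1 ≤ (n : ℝ≥0∞)) := ⟨by exact_mod_cast (by lia : 1 ≤ n)⟩
  set P : ℝ := (p : ℝ) ^ (1 / n : ℝ) with hP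
  have hP0 : 0 < P := by positivity
  have hPn : P ^ n = p := by
    rw [hP, one_div (n : ℝ), Real.rpow_inv_natCast_pow hp0.le (by lia)]
  have hnorm : ∀ g : ZMod p → ℂ, ‖WithLp.toLp (n : ℝ≥0∞) g‖ = (∑ z, ‖g z‖ ^ n) ^ (1 / n : ℝ) := by
    intro g
    rw [PiLp.norm_eq_sum (by simp; lia)]
    simp
  have hblock : ∀ j, ‖WithLp.toLp (n : ℝ≥0∞) (f j)‖ ≤ P * √p * q ^ j := by
    intro j
    have h1 : ∑ z, ‖f j z‖ ^ n ≤ (P * √p * q ^ j) ^ n := by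
      calc ∑ z, ‖f j z‖ ^ n ≤ ∑ z, √p ^ (n - 2) * ‖f j z‖ ^ 2 := by
            refine Finset.sum_le_sum fun z _ => ?_
            conv_lhs => rw [← Nat.sub_add_cancel hn, pow_add]
            gcongr
            exact hf1 j z
        _ ≤ √p ^ (n - 2) * ((p : ℝ) ^ 2 * (1 / 2) ^ j) := by
            rw [← Finset.mul_sum]
            gcongr
            exact hf2 j
        _ = √p ^ (n - 2) * (√p ^ 2) * p * (1 / 2) ^ j := by
            rw [Real.sq_sqrt hp0.le]; ring
        _ = _ := by
            rw [← pow_add, Nat.sub_add_cancel hn, mul_pow, mul_pow, hPn, ← pow_mul, mul_comm j n,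
              pow_mul, hqn]
            ring
    rw [hnorm]
    calc _ ≤ ((P * √p * q ^ j) ^ n) ^ (1 / n : ℝ) := by gcongr
      _ = _ := by
        rw [one_div, Real.pow_rpow_inv_natCast (by positivity) (by lia)]
  have hsum : ‖WithLp.toLp (n : ℝ≥0∞) (fun z => (s z : ℂ))‖ ≤ P * √p * (1 - q)⁻¹ := by
    have h1 : WithLp.toLp (n : ℝ≥0∞) (fun z => (s z : ℂ)) =
        ∑ j ∈ Finset.range (Nat.log 2 p + 1), WithLp.toLp (n : ℝ≥0∞) (f j) := by
      rw [← WithLp.toLp_sum]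
      congr 1
      ext z
      rw [hf z, Finset.sum_apply]
    rw [h1]
    refine (norm_sum_le_of_le _ fun j _ => hblock j).trans ?_
    rw [← Finset.mul_sum]
    gcongr
    rw [← tsum_geometric_of_lt_one hq0.le hq1]
    exact (summable_geometric_of_lt_one hq0.le hq1).sum_le_tsum _ fun j _ => by positivity
  rw [hnorm] at hsum
  simp only [Complex.norm_real, Real.norm_eq_abs] at hsum
  have h2 := pow_le_pow_left₀ (by positivity) hsum n
  rw [one_div, Real.rpow_inv_natCast_pow (by positivity) (by lia)] at h2
  refine h2.trans_eq ?_
  rw [mul_assoc, mul_pow, hPn, mul_comm (√(p : ℝ))]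

end Moments

/-! ### Generalities on Wasserstein distances -/

section Wasserstein

theorem wasserstein_mono_exponent {X : Type*} [PseudoMetricSpace X] [MeasurableSpace X]
    [OpensMeasurableSpace X] [SecondCountableTopology X] {q r : ℝ≥0∞} (hqr : q ≤ r)
    (μ ν : Measure X) : wasserstein q μ ν ≤ wasserstein r μ ν := by
  refine iInf₂_mono fun π hπ => ?_
  have := hπ.1
  exact eLpNorm_le_eLpNorm_of_exponent_le hqr continuous_dist.aestronglyMeasurable

theorem wasserstein_le_of_dist_le {X : Type*} [PseudoMetricSpace X] [MeasurableSpace X]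
    {D : ℝ} (hD : ∀ x y : X, dist x y ≤ D) (r : ℝ≥0∞) (μ ν : Measure X)
    [IsProbabilityMeasure μ] [IsProbabilityMeasure ν] :
    wasserstein r μ ν ≤ ENNReal.ofReal D := by
  refine (iInf₂_le (μ.prod ν) ⟨inferInstance, by simp, by simp⟩).trans ?_
  refine (eLpNorm_le_of_ae_bound (C := D) (.of_forall fun z => ?_)).trans (by simp)
  rw [Real.norm_of_nonneg dist_nonneg]
  exact hD _ _

theorem isProbabilityMeasure_empiricalMeasure {X : Type*} [MeasurableSpace X] (x : ℕ → X) {N : ℕ}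
    (hN : N ≠ 0) : IsProbabilityMeasure (empiricalMeasure x N) := by
  refine ⟨?_⟩
  simp only [empiricalMeasure, Measure.smul_apply, Measure.finsetSum_apply, measure_univ,
    Finset.sum_const, Nat.card_Icc, smul_eq_mul, nsmul_eq_mul, mul_one, Nat.add_sub_cancel]
  exact ENNReal.inv_mul_cancel (by simpa using hN) (by simp)

theorem eLpNorm_dist_natCast {X : Type*} [PseudoMetricSpace X] [CompactSpace X]
    [MeasurableSpace X] [BorelSpace X] [SecondCountableTopology X] {n : ℕ} (hn : n ≠ 0)
    (π : Measure (X × X)) [IsFiniteMeasure π] :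
    eLpNorm (fun z : X × X => dist z.1 z.2) n π =
      ENNReal.ofReal ((∫ z, dist z.1 z.2 ^ n ∂π) ^ (n : ℝ)⁻¹) := by
  have hc : Continuous fun z : X × X => dist z.1 z.2 := continuous_dist
  obtain ⟨C, hC⟩ := isCompact_univ.exists_bound_of_continuousOn (f := fun z : X × X => dist z.1 z.2)
    hc.continuousOn
  have hm : MemLp (fun z : X × X => dist z.1 z.2) n π :=
    MemLp.of_bound hc.aestronglyMeasurable C (.of_forall fun z => hC z trivial)
  rw [hm.eLpNorm_eq_integral_rpow_norm (by simpa using hn) (by simp)]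
  simp

theorem Continuous.integrable_of_compactSpace {X : Type*} [TopologicalSpace X] [CompactSpace X]
    [MeasurableSpace X] [OpensMeasurableSpace X] {f : X → ℝ} (hf : Continuous f) (μ : Measure X)
    [IsFiniteMeasure μ] : Integrable f μ := by
  obtain ⟨C, hC⟩ := isCompact_univ.exists_bound_of_continuousOn hf.continuousOn
  exact Integrable.of_bound hf.aestronglyMeasurable C (.of_forall fun z => hC z trivial)

end Wasserstein

/-! ### Transporting arcs of the circle to points -/

section Cells

/-- The image on the circle of Lebesgue measure on the interval `(a, c]`. -/
noncomputable def arcMeasure (a c : ℝ) : Measure UnitAddCircle :=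
  (volume.restrict (Set.Ioc a c)).map fun y : ℝ => (y : UnitAddCircle)

theorem arcMeasure_add {a c d : ℝ} (h : a ≤ c) (h' : c ≤ d) :
    arcMeasure a c + arcMeasure c d = arcMeasure a d := by
  rw [arcMeasure, arcMeasure, arcMeasure, ← Measure.map_add _ _ AddCircle.measurable_mk',
    ← Measure.restrict_union (Set.Ioc_disjoint_Ioc_of_le le_rfl) measurableSet_Ioc,
    Set.Ioc_union_Ioc_eq_Ioc h h']

theorem sum_arcMeasure {b : ℕ → ℝ} (hb : Monotone b) (n : ℕ) :
    ∑ i ∈ Finset.range n, arcMeasure (b i) (b (i + 1)) = arcMeasure (b 0) (b n) := by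
  induction n with
  | zero => simp [arcMeasure]
  | succ n ih => rw [Finset.sum_range_succ, ih, arcMeasure_add (hb (Nat.zero_le n)) (hb n.le_succ)]

theorem arcMeasure_add_one (a : ℝ) : arcMeasure a (a + 1) = volume :=
  (UnitAddCircle.measurePreserving_mk a).map_eq

instance (a c : ℝ) : IsFiniteMeasure (arcMeasure a c) := by
  unfold arcMeasure; infer_instance

theorem arcMeasure_univ (a c : ℝ) : arcMeasure a c Set.univ = ENNReal.ofReal (c - a) := by
  rw [arcMeasure, Measure.map_apply AddCircle.measurable_mk' MeasurableSet.univ]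
  simp

theorem integral_arcMeasure {a c : ℝ} (h : a ≤ c) {f : UnitAddCircle → ℝ} (hf : Continuous f) :
    ∫ u, f u ∂arcMeasure a c = ∫ y in a..c, f y := by
  rw [arcMeasure, integral_map AddCircle.measurable_mk'.aemeasurable hf.aestronglyMeasurable,
    intervalIntegral.integral_of_le h]

theorem integral_eq_sum_intervalIntegral {b : ℕ → ℝ} (hb : Monotone b) {n : ℕ}
    (hbn : b n = b 0 + 1) {f : UnitAddCircle → ℝ} (hf : Continuous f) :
    ∫ u, f u = ∑ i ∈ Finset.range n, ∫ y in (b i)..(b (i + 1)), f y := by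
  rw [← arcMeasure_add_one (b 0), ← hbn, ← sum_arcMeasure hb,
    integral_finsetSum_measure fun i _ => hf.integrable_of_compactSpace _]
  exact Finset.sum_congr rfl fun i _ => integral_arcMeasure (hb i.le_succ) hf

/-- The coupling which transports the arcs `(b i, b (i + 1)]` to the points `x i`. -/
noncomputable def arcCoupling (b : ℕ → ℝ) (x : ℕ → UnitAddCircle) (n : ℕ) :
    Measure (UnitAddCircle × UnitAddCircle) :=
  ∑ i ∈ Finset.range n, (Measure.dirac (x i)).prod (arcMeasure (b i) (b (i + 1)))

/-- The condition `b n = b 0 + 1` says that the arcs tile the circle exactly once. -/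
theorem arcCoupling_mem_couplings {b : ℕ → ℝ} (hb : Monotone b) (x : ℕ → UnitAddCircle) {n : ℕ}
    (hbn : b n = b 0 + 1) :
    arcCoupling b x n ∈ couplings
      (∑ i ∈ Finset.range n, ENNReal.ofReal (b (i + 1) - b i) • Measure.dirac (x i)) volume := by
  have hsnd : (arcCoupling b x n).snd = volume := by
    rw [← arcMeasure_add_one (b 0), ← hbn, ← sum_arcMeasure hb, arcCoupling, Measure.snd,
      Measure.map_finset_sum measurable_snd.aemeasurable]
    refine Finset.sum_congr rfl fun i _ => ?_
    rw [← Measure.snd, Measure.snd_prod]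
  have hfst : (arcCoupling b x n).fst =
      ∑ i ∈ Finset.range n, ENNReal.ofReal (b (i + 1) - b i) • Measure.dirac (x i) := by
    rw [arcCoupling, Measure.fst, Measure.map_finset_sum measurable_fst.aemeasurable]
    refine Finset.sum_congr rfl fun i _ => ?_
    rw [Measure.map_fst_prod, arcMeasure_univ]
  refine ⟨⟨?_⟩, hfst, hsnd⟩
  rw [← Measure.snd_univ, hsnd]
  simp

theorem wasserstein_natCast_le_of_arcs {b : ℕ → ℝ} (hb : Monotone b) (x : ℕ → UnitAddCircle)
    {n : ℕ} (hbn : b n = b 0 + 1) {m : ℕ} (hm : m ≠ 0) :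
    wasserstein m (∑ i ∈ Finset.range n, ENNReal.ofReal (b (i + 1) - b i) • Measure.dirac (x i))
      volume ≤ ENNReal.ofReal
        ((∑ i ∈ Finset.range n, ∫ y in (b i)..(b (i + 1)), dist (x i) y ^ m) ^ (m : ℝ)⁻¹) := by
  have hπ := arcCoupling_mem_couplings hb x hbn
  refine (iInf₂_le _ hπ).trans_eq ?_
  have := hπ.1
  have hc : Continuous fun z : UnitAddCircle × UnitAddCircle => dist z.1 z.2 ^ m := by fun_prop
  rw [eLpNorm_dist_natCast hm, arcCoupling,
    integral_finsetSum_measure fun i _ => hc.integrable_of_compactSpace _]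
  congr 2
  refine Finset.sum_congr rfl fun i _ => ?_
  rw [Measure.dirac_prod, integral_map (by fun_prop) hc.aestronglyMeasurable]
  exact integral_arcMeasure (hb i.le_succ) (f := fun u => dist (x i) u ^ m) (by fun_prop)

theorem wasserstein_le_of_arcs {b : ℕ → ℝ} (hb : Monotone b) (x : ℕ → UnitAddCircle)
    {n : ℕ} (hbn : b n = b 0 + 1) {D : ℝ}
    (hD : ∀ i < n, ∀ y ∈ Set.Ioc (b i) (b (i + 1)), dist (x i) y ≤ D) :
    wasserstein ∞ (∑ i ∈ Finset.range n, ENNReal.ofReal (b (i + 1) - b i) • Measure.dirac (x i))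
      volume ≤ ENNReal.ofReal D := by
  have hπ := arcCoupling_mem_couplings hb x hbn
  refine (iInf₂_le _ hπ).trans ?_
  rw [eLpNorm_exponent_top]
  refine eLpNormEssSup_le_of_ae_bound ?_
  have hms : MeasurableSet {z : UnitAddCircle × UnitAddCircle | ‖dist z.1 z.2‖ ≤ D} :=
    (isClosed_le (by fun_prop) continuous_const).measurableSet
  rw [ae_iff, arcCoupling, Measure.finsetSum_apply]
  refine Finset.sum_eq_zero fun i hi => ?_
  rw [← ae_iff, Measure.dirac_prod, ae_map_iff (by fun_prop) hms, arcMeasure]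
  refine (ae_map_iff AddCircle.measurable_mk'.aemeasurable
    (measurableSet_preimage (by fun_prop : Measurable (Prod.mk (x i))) hms)).2 ?_
  filter_upwards [ae_restrict_mem measurableSet_Ioc] with y hy
  rw [Real.norm_of_nonneg dist_nonneg]
  exact hD i (Finset.mem_range.1 hi) y hy

/-- Weak Kantorovich duality. The first marginal is atomic, so the constraint is needed only at the
atoms and `Φ` need not be continuous. -/
theorem le_integral_of_mem_couplings {X : Type*} [MeasurableSpace X] [MeasurableSingletonClass X]
    [TopologicalSpace X] [CompactSpace X] [OpensMeasurableSpace X]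
    {n : ℕ} {w : ℕ → ℝ} (hw : ∀ i, 0 ≤ w i) {x : ℕ → X}
    {ν : Measure X} {π : Measure (X × X)}
    (hπ : π ∈ couplings (∑ i ∈ Finset.range n, ENNReal.ofReal (w i) • Measure.dirac (x i)) ν)
    {Φ : X → ℝ} (hΦ : Measurable Φ) {M : ℝ} (hM : ∀ u, |Φ u| ≤ M)
    {ψ : X → ℝ} (hψ : Continuous ψ) {f : X × X → ℝ} (hf : Integrable f π)
    (h : ∀ i < n, ∀ u, Φ (x i) + ψ u ≤ f (x i, u)) :
    ∑ i ∈ Finset.range n, w i * Φ (x i) + ∫ u, ψ u ∂ν ≤ ∫ z, f z ∂π := by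
  obtain ⟨hprob, h1, h2⟩ := hπ
  have hν : IsFiniteMeasure ν := by rw [← h2]; infer_instance
  have hΦi : ∀ κ : Measure X, IsFiniteMeasure κ → Integrable Φ κ := fun κ _ =>
    Integrable.of_bound hΦ.aestronglyMeasurable M (.of_forall hM)
  have e1 : ∑ i ∈ Finset.range n, w i * Φ (x i) = ∫ z, Φ z.1 ∂π := by
    rw [← integral_map (φ := Prod.fst) measurable_fst.aemeasurable hΦ.aestronglyMeasurable,
      ← Measure.fst, h1, integral_finsetSum_measure fun i _ => (hΦi _ inferInstance).smul_measure
        ENNReal.ofReal_ne_top]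
    refine Finset.sum_congr rfl fun i _ => ?_
    rw [integral_smul_measure, integral_dirac, ENNReal.toReal_ofReal (hw i), smul_eq_mul]
  have e2 : ∫ u, ψ u ∂ν = ∫ z, ψ z.2 ∂π := by
    rw [← integral_map (φ := Prod.snd) measurable_snd.aemeasurable (by
      rw [← Measure.snd, h2]; exact (hψ.integrable_of_compactSpace ν).1), ← Measure.snd, h2]
  have i1 : Integrable (fun z : X × X => Φ z.1) π := by
    refine Integrable.of_bound (hΦ.comp measurable_fst).aestronglyMeasurable M (.of_forall fun z => hM z.1)
  have i2 : Integrable (fun z : X × X => ψ z.2) π := by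
    have : Integrable ψ (π.map Prod.snd) := by
      rw [← Measure.snd, h2]; exact hψ.integrable_of_compactSpace ν
    exact this.comp_measurable measurable_snd
  rw [e1, e2, ← integral_add i1 i2]
  refine integral_mono_ae (i1.add i2) hf ?_
  have hae : ∀ᵐ u ∂π.map Prod.fst, ∃ i < n, u = x i := by
    rw [← Measure.fst, h1, ae_iff, Measure.finsetSum_apply]
    refine Finset.sum_eq_zero fun i hi => ?_
    have : ∀ᵐ u ∂Measure.dirac (x i), ∃ i < n, u = x i := by
      rw [ae_dirac_eq]
      exact ⟨i, Finset.mem_range.1 hi, rfl⟩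
    rw [Measure.smul_apply, ae_iff.1 this, smul_zero]
  filter_upwards [ae_of_ae_map measurable_fst.aemeasurable hae] with z hz
  obtain ⟨i, hi, hzi⟩ := hz
  have := h i hi z.2
  rw [← hzi] at this
  exact this

end Cells

/-! ### The optimal transport of the circle to the quadratic residues -/

section Residues

variable {p : ℕ} [Fact p.Prime]

theorem quadraticResidueMeasure_eq_sum (hp : p ≠ 2) :
    quadraticResidueMeasure p = ∑ i ∈ Finset.range p,
      ENNReal.ofReal ((1 + (quadraticChar (ZMod p) (i : ZMod p) : ℝ)) / p) •
        Measure.dirac (ZMod.toAddCircle (i : ZMod p)) := by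
  have hp' : ringChar (ZMod p) ≠ 2 := by rwa [ZMod.ringChar_zmod_n]
  have hp0 : 0 < p := (Fact.out : p.Prime).pos
  have h1 : ∑ m ∈ Finset.Icc 1 p, Measure.dirac (((m : ℝ) ^ 2 / (p : ℝ) : ℝ) : UnitAddCircle) =
      ∑ z : ZMod p, Measure.dirac (ZMod.toAddCircle (z ^ 2)) := by
    have h2 : ∀ m : ℕ, Measure.dirac (((m : ℝ) ^ 2 / (p : ℝ) : ℝ) : UnitAddCircle) =
        Measure.dirac (ZMod.toAddCircle ((m : ZMod p) ^ 2)) := by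
      intro m
      rw [← Nat.cast_pow, ← Nat.cast_pow, ZMod.toAddCircle_natCast]
    simp only [h2]
    -- The indices `1..p` and `0..p-1` differ only in `p` versus `0`, which are the same residue.
    rw [ZMod.sum_eq_sum_range, ← Finset.sum_erase_add _ _ (Finset.right_mem_Icc.2 hp0),
      ← Finset.add_sum_erase _ _ (Finset.mem_range.2 hp0), add_comm]
    congr 1
    · simp
    · refine Finset.sum_congr ?_ fun _ _ => rfl
      ext i
      simp only [Finset.mem_erase, Finset.mem_Icc, Finset.mem_range]
      lia
  have h3 : ∑ z : ZMod p, Measure.dirac (ZMod.toAddCircle (z ^ 2)) =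
      ∑ a : ZMod p, ENNReal.ofReal (1 + (quadraticChar (ZMod p) a : ℝ)) •
        Measure.dirac (ZMod.toAddCircle a) := by
    rw [← Finset.sum_fiberwise_of_maps_to (g := fun z : ZMod p => z ^ 2)
      (fun z _ => Finset.mem_univ _)]
    refine Finset.sum_congr rfl fun a _ => ?_
    rw [Finset.sum_congr rfl (g := fun _ => Measure.dirac (ZMod.toAddCircle a)) fun z hz => by
      rw [(Finset.mem_filter.1 hz).2], Finset.sum_const, ← Nat.cast_smul_eq_nsmul ℝ≥0∞]
    congr 1
    have h4 := quadraticChar_card_sqrts hp' a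
    have h5 : {x : ZMod p | x ^ 2 = a}.toFinset =
        Finset.univ.filter fun z : ZMod p => z ^ 2 = a := by
      ext; simp
    rw [h5] at h4
    have h6 : (1 + (quadraticChar (ZMod p) a : ℝ)) =
        ((Finset.univ.filter fun z : ZMod p => z ^ 2 = a).card : ℝ) := by
      rw [add_comm]; exact_mod_cast h4.symm
    rw [h6, ENNReal.ofReal_natCast]
  rw [quadraticResidueMeasure, empiricalMeasure, h1, h3, Finset.smul_sum, ZMod.sum_eq_sum_range]
  refine Finset.sum_congr rfl fun i _ => ?_
  rw [smul_smul, ENNReal.ofReal_div_of_pos (by exact_mod_cast hp0), ENNReal.ofReal_natCast,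
    ENNReal.div_eq_inv_mul]

/-- The left end of the arc of the circle which is transported to the point `k / p`. -/
noncomputable def arcEnd (s : ZMod p → ℝ) (k : ℤ) : ℝ := (k - 1 / 2 + s k) / p

variable {s : ZMod p → ℝ} (hs : ∀ z, s (z + 1) - s z = quadraticChar (ZMod p) z)

theorem cast_prime_pos (p : ℕ) [Fact p.Prime] : (0 : ℝ) < p := by
  exact_mod_cast (Fact.out : p.Prime).pos

theorem neg_one_le_quadraticChar (z : ZMod p) : -1 ≤ (quadraticChar (ZMod p) z : ℝ) ∧
    (quadraticChar (ZMod p) z : ℝ) ≤ 1 := by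
  rcases quadraticChar_isQuadratic (ZMod p) z with h | h | h <;> rw [h] <;> norm_num

include hs

theorem arcEnd_add_one_sub (k : ℤ) :
    arcEnd s (k + 1) - arcEnd s k = (1 + (quadraticChar (ZMod p) (k : ZMod p) : ℝ)) / p := by
  rw [arcEnd, arcEnd, ← hs]
  push_cast
  ring

/-- This is `χ ≥ -1`; the arcs of nonresidues are empty. -/
theorem arcEnd_monotone : Monotone (arcEnd s) := by
  refine monotone_int_of_le_succ fun k => ?_
  rw [← sub_nonneg, arcEnd_add_one_sub hs]
  have := (neg_one_le_quadraticChar (k : ZMod p)).1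
  have := cast_prime_pos p
  exact div_nonneg (by linarith) this.le

theorem monotone_arcEnd_natCast : Monotone fun i : ℕ => arcEnd s i := fun i j h =>
  arcEnd_monotone hs (by exact_mod_cast h)

omit hs in
theorem arcEnd_prime : arcEnd s ((p : ℕ) : ℤ) = arcEnd s ((0 : ℕ) : ℤ) + 1 := by
  have := (cast_prime_pos p).ne'
  rw [arcEnd, arcEnd]
  simp
  field_simp
  ring

theorem quadraticResidueMeasure_eq_sum_arcEnd (hp : p ≠ 2) :
    quadraticResidueMeasure p = ∑ i ∈ Finset.range p,
      ENNReal.ofReal (arcEnd s ((i + 1 : ℕ) : ℤ) - arcEnd s (i : ℤ)) •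
        Measure.dirac (ZMod.toAddCircle (i : ZMod p)) := by
  rw [quadraticResidueMeasure_eq_sum hp]
  refine Finset.sum_congr rfl fun i _ => ?_
  rw [Nat.cast_succ, arcEnd_add_one_sub hs, Int.cast_natCast]

omit hs in
theorem dist_toAddCircle_natCast_le (i : ℕ) (y : ℝ) :
    dist (ZMod.toAddCircle (i : ZMod p)) (y : UnitAddCircle) ≤ |y - i / p| := by
  rw [ZMod.toAddCircle_natCast, dist_comm, dist_eq_norm, ← AddCircle.coe_sub,
    UnitAddCircle.norm_eq]
  simpa using round_le (y - i / p) 0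

omit hs in
theorem abs_sub_le_of_mem_arc {i : ℕ} {y : ℝ}
    (hy : y ∈ Set.Icc (arcEnd s (i : ℤ)) (arcEnd s ((i + 1 : ℕ) : ℤ))) :
    |y - i / p| ≤ (|s i| + |s (i + 1)| + 1) / p := by
  have hp0 := cast_prime_pos p
  obtain ⟨h1, h2⟩ := hy
  have e1 : arcEnd s (i : ℤ) - i / p = (s i - 1 / 2) / p := by
    rw [arcEnd]; push_cast; ring
  have e2 : arcEnd s ((i + 1 : ℕ) : ℤ) - i / p = (s (i + 1) + 1 / 2) / p := by
    rw [arcEnd]; push_cast; ring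
  have b1 : -((|s i| + |s (i + 1)| + 1) / p) ≤ (s i - 1 / 2) / p := by
    rw [← neg_div]
    gcongr
    linarith [neg_abs_le (s i), abs_nonneg (s (i + 1))]
  have b2 : (s (i + 1) + 1 / 2) / p ≤ (|s i| + |s (i + 1)| + 1) / p := by
    rw [div_le_div_iff_of_pos_right hp0]
    linarith [le_abs_self (s (i + 1)), abs_nonneg (s i)]
  rw [abs_le]
  constructor <;> linarith

/-- The quadratic cost of transporting the uniform measure on the circle to the quadratic
residues. -/
theorem sum_integral_arc_sq (hp : p ≠ 2) (hs0 : ∑ z, s z = 0) :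
    ∑ i ∈ Finset.range p, ∫ y in (arcEnd s (i : ℤ))..(arcEnd s ((i + 1 : ℕ) : ℤ)),
      (y - i / p) ^ 2 = ((p : ℝ) ^ 2 + p - 1) / (12 * p ^ 3) := by
  have hp0 := (cast_prime_pos p).ne'
  have h1 : ∀ i : ℕ, ∫ y in (arcEnd s (i : ℤ))..(arcEnd s ((i + 1 : ℕ) : ℤ)), (y - i / p) ^ 2 =
      ((s ((i : ZMod p) + 1) + 1 / 2) ^ 3 - (s i - 1 / 2) ^ 3) / (3 * p ^ 3) := by
    intro i
    rw [intervalIntegral.integral_comp_sub_right (fun y => y ^ 2), integral_pow, arcEnd, arcEnd]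
    push_cast
    field_simp
    ring
  -- Shifting `z + 1` to `z` in the first cube pairs both cubes at the same `s z`, leaving `3 s² +
  -- 1/4`.
  rw [Finset.sum_congr rfl fun i _ => h1 i, ← ZMod.sum_eq_sum_range p fun z =>
    ((s (z + 1) + 1 / 2) ^ 3 - (s z - 1 / 2) ^ 3) / (3 * (p : ℝ) ^ 3), ← Finset.sum_div,
    Finset.sum_sub_distrib, Fintype.sum_bijective (fun z : ZMod p => z + 1)
      (AddGroup.addRight_bijective 1) _ (fun z => (s z + 1 / 2) ^ 3) fun z => rfl,
    ← Finset.sum_sub_distrib]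
  have h2 : ∀ z, (s z + 1 / 2) ^ 3 - (s z - 1 / 2) ^ 3 = 3 * s z ^ 2 + 1 / 4 := fun z => by ring
  rw [Finset.sum_congr rfl fun z _ => h2 z, Finset.sum_add_distrib, ← Finset.mul_sum,
    sum_sq_of_sum_eq_zero hs hp hs0]
  simp only [Finset.sum_const, Finset.card_univ, ZMod.card, nsmul_eq_mul]
  field_simp
  ring

omit hs in
theorem continuous_sq_dist_circle (u : UnitAddCircle) :
    Continuous fun v : UnitAddCircle => dist u v ^ 2 := by fun_prop

/-- The complementary slackness condition satisfied by the Kantorovich potential `φ` of the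
transport of the circle to the quadratic residues. -/
theorem sq_sub_sub_le_of_mem_arc {φ : ZMod p → ℝ}
    (hφ : ∀ z, φ (z + 1) - φ z = -(2 / p ^ 2) * s (z + 1)) {i : ℕ} {y : ℝ}
    (hy : y ∈ Set.Icc (arcEnd s (i : ℤ)) (arcEnd s ((i + 1 : ℕ) : ℤ))) (z : ZMod p) :
    (y - i / p) ^ 2 - φ i ≤ dist (ZMod.toAddCircle z) (y : UnitAddCircle) ^ 2 - φ z := by
  have hp0 := cast_prime_pos p
  -- The reduced cost, as a function of `k`, increases exactly when `arcEnd s (k + 1)` exceeds `y`.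
  -- As the ends are monotone, its minimum over `ℤ` is at the arc containing `y`.
  have hstep : ∀ k : ℤ, ((y - (k + 1 : ℤ) / p) ^ 2 - φ (k + 1 : ℤ)) - ((y - k / p) ^ 2 - φ k) =
      2 / p * (arcEnd s (k + 1) - y) := by
    intro k
    have := hφ k
    rw [arcEnd]
    push_cast
    rw [eq_add_of_sub_eq this]
    field_simp
    ring
  have hup : ∀ k : ℤ, (i : ℤ) ≤ k → (y - (i : ℤ) / p) ^ 2 - φ (i : ℤ) ≤ (y - k / p) ^ 2 - φ k := by
    intro k hk
    induction k, hk using Int.leInduction with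
    | base => exact le_rfl
    | succ k hk ih =>
      refine ih.trans (sub_nonneg.1 ?_)
      rw [hstep]
      have : arcEnd s ((i + 1 : ℕ) : ℤ) ≤ arcEnd s (k + 1) := arcEnd_monotone hs (by push_cast; lia)
      exact mul_nonneg (by positivity) (by linarith [hy.2])
  have hdown : ∀ k : ℤ, k ≤ (i : ℤ) → (y - (i : ℤ) / p) ^ 2 - φ (i : ℤ) ≤ (y - k / p) ^ 2 - φ k := by
    intro k hk
    induction k, hk using Int.leInductionDown with
    | base => exact le_rfl
    | pred k hk ih =>
      refine ih.trans (sub_nonpos.1 ?_)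
      have h := hstep (k - 1)
      rw [sub_add_cancel] at h
      rw [h]
      have : arcEnd s k ≤ arcEnd s (i : ℤ) := arcEnd_monotone hs hk
      exact mul_nonpos_of_nonneg_of_nonpos (by positivity) (by linarith [hy.1])
  -- Choose the integer lift of `z` for which `k/p` is nearest to `y`, so that circle distance
  -- becomes distance on the line.
  obtain ⟨k, hkz, hk⟩ : ∃ k : ℤ, (k : ZMod p) = z ∧
      dist (ZMod.toAddCircle z) (y : UnitAddCircle) = |y - k / p| := by
    refine ⟨z.val + round (y - z.val / p) * p, by simp, ?_⟩
    rw [dist_comm, dist_eq_norm, ZMod.toAddCircle_apply, ← AddCircle.coe_sub,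
      UnitAddCircle.norm_eq]
    congr 1
    push_cast
    field_simp
    ring
  rw [hk, sq_abs, ← hkz]
  have := (le_total (i : ℤ) k).elim (hup k) (hdown k)
  simpa using this

/-- Duality with the potential `φ` and its transform `ψ`: on the `i`-th arc `ψ` is at least `(y -
i/p)² - φ i`, so the `φ` terms cancel against the atoms and the arc cost remains. -/
theorem cost_le_of_mem_couplings (hp : p ≠ 2) (hs0 : ∑ z, s z = 0)
    {π : Measure (UnitAddCircle × UnitAddCircle)}
    (hπ : π ∈ couplings (quadraticResidueMeasure p) volume) :
    ((p : ℝ) ^ 2 + p - 1) / (12 * p ^ 3) ≤ ∫ z, dist z.1 z.2 ^ 2 ∂π := by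
  obtain ⟨φ, hφ⟩ := ZMod.exists_forall_add_one_sub (fun z => -(2 / (p : ℝ) ^ 2) * s (z + 1)) (by
    rw [← Finset.mul_sum, Fintype.sum_bijective (fun z : ZMod p => z + 1)
      (AddGroup.addRight_bijective 1) _ s fun z => rfl, hs0, mul_zero])
  set ψ : UnitAddCircle → ℝ := fun u => Finset.univ.inf' Finset.univ_nonempty
    fun z : ZMod p => dist (ZMod.toAddCircle z) u ^ 2 - φ z with hψ
  have hψc : Continuous ψ := by
    refine Continuous.finset_inf'_apply _ fun z _ => ?_
    exact (continuous_sq_dist_circle _).sub continuous_const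
  set Φ : UnitAddCircle → ℝ := fun u => ∑ z, if u = ZMod.toAddCircle z then φ z else 0 with hΦ
  have hΦm : Measurable Φ := Finset.measurable_sum _ fun z _ =>
    Measurable.ite (measurableSet_singleton _) measurable_const measurable_const
  have hΦb : ∀ u, |Φ u| ≤ ∑ z, |φ z| := fun u => by
    refine (Finset.abs_sum_le_sum_abs _ _).trans (Finset.sum_le_sum fun z _ => ?_)
    split_ifs <;> simp
  have hΦz : ∀ z, Φ (ZMod.toAddCircle z) = φ z := fun z => by simp [hΦ]
  have hprob := hπ.1
  rw [quadraticResidueMeasure_eq_sum_arcEnd hs hp] at hπ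
  have hmono := monotone_arcEnd_natCast hs
  have hf : Continuous fun z : UnitAddCircle × UnitAddCircle => dist z.1 z.2 ^ 2 := by fun_prop
  refine le_trans ?_ (le_integral_of_mem_couplings
    (w := fun i : ℕ => arcEnd s ((i + 1 : ℕ) : ℤ) - arcEnd s (i : ℤ))
    (fun i => sub_nonneg.2 (hmono i.le_succ)) hπ hΦm hΦb hψc (hf.integrable_of_compactSpace π)
    fun i _ u => ?_)
  · rw [integral_eq_sum_intervalIntegral hmono arcEnd_prime hψc, ← sum_integral_arc_sq hs hp hs0,
      ← Finset.sum_add_distrib]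
    refine Finset.sum_le_sum fun i _ => ?_
    have hint : ∫ y in (arcEnd s (i : ℤ))..(arcEnd s ((i + 1 : ℕ) : ℤ)), ((y - i / p) ^ 2 - φ i) ≤
        ∫ y in (arcEnd s (i : ℤ))..(arcEnd s ((i + 1 : ℕ) : ℤ)), ψ y := by
      refine intervalIntegral.integral_mono_on (hmono i.le_succ)
        (Continuous.intervalIntegrable (by fun_prop) _ _)
        ((hψc.comp (AddCircle.continuous_mk' 1)).intervalIntegrable _ _) fun y hy => ?_
      exact Finset.le_inf' _ _ fun z _ => sq_sub_sub_le_of_mem_arc hs hφ hy z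
    rw [intervalIntegral.integral_sub (Continuous.intervalIntegrable (by fun_prop) _ _)
      (by simp), intervalIntegral.integral_const, smul_eq_mul] at hint
    rw [hΦz]
    linarith
  · rw [hΦz]
    have : ψ u ≤ dist (ZMod.toAddCircle (i : ZMod p)) u ^ 2 - φ i :=
      Finset.inf'_le _ (Finset.mem_univ _)
    linarith

end Residues

/-! ### Assembling the bounds for odd primes, and the prime 2 -/

section Main

variable {p : ℕ} [Fact p.Prime]

theorem exists_mean_zero_partial_sums (hp : p ≠ 2) : ∃ s : ZMod p → ℝ,
    (∀ z, s (z + 1) - s z = quadraticChar (ZMod p) z) ∧ ∑ z, s z = 0 := by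
  have hp' : ringChar (ZMod p) ≠ 2 := by rwa [ZMod.ringChar_zmod_n]
  obtain ⟨S, hS⟩ := ZMod.exists_forall_add_one_sub
    (fun z : ZMod p => (quadraticChar (ZMod p) z : ℝ)) (by
      exact_mod_cast quadraticChar_sum_zero hp')
  refine ⟨fun z => S z - (∑ w, S w) / p, fun z => by rw [← hS]; ring, ?_⟩
  rw [Finset.sum_sub_distrib, Finset.sum_const, Finset.card_univ, ZMod.card, nsmul_eq_mul,
    mul_div_cancel₀ _ (cast_prime_pos p).ne', sub_self]

theorem wasserstein_two_quadraticResidueMeasure (hp : p ≠ 2) :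
    wasserstein 2 (quadraticResidueMeasure p) (volume : Measure UnitAddCircle) =
      ENNReal.ofReal √(((p : ℝ) ^ 2 + (p : ℝ) - 1) / (12 * (p : ℝ) ^ 3)) := by
  obtain ⟨s, hs, hs0⟩ := exists_mean_zero_partial_sums hp
  have hmono := monotone_arcEnd_natCast hs
  have h2 : ((2 : ℕ) : ℝ≥0∞) = 2 := by norm_num
  have hsqrt : ∀ x : ℝ, x ^ ((2 : ℕ) : ℝ)⁻¹ = √x := fun x => by
    rw [Real.sqrt_eq_rpow]; norm_num
  refine le_antisymm ?_ (le_iInf₂ fun π hπ => ?_)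
  · have h := wasserstein_natCast_le_of_arcs hmono (fun i => ZMod.toAddCircle (i : ZMod p))
      arcEnd_prime two_ne_zero
    rw [← quadraticResidueMeasure_eq_sum_arcEnd hs hp, h2, hsqrt] at h
    refine h.trans (ENNReal.ofReal_le_ofReal (Real.sqrt_le_sqrt ?_))
    rw [← sum_integral_arc_sq hs hp hs0]
    refine Finset.sum_le_sum fun i _ => ?_
    refine intervalIntegral.integral_mono_on (hmono i.le_succ)
      (((continuous_sq_dist_circle _).comp (AddCircle.continuous_mk' 1)).intervalIntegrable _ _)
      (Continuous.intervalIntegrable (by fun_prop) _ _) fun y _ => ?_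
    rw [← sq_abs (y - i / p)]
    gcongr
    exact dist_toAddCircle_natCast_le i y
  · have := hπ.1
    rw [← h2, eLpNorm_dist_natCast two_ne_zero, hsqrt]
    exact ENNReal.ofReal_le_ofReal (Real.sqrt_le_sqrt (cost_le_of_mem_couplings hs hp hs0 hπ))

theorem exists_wasserstein_natCast_le {n : ℕ} (hn : 2 ≤ n) : ∃ C : ℝ, 1 ≤ C ∧
    ∀ {p : ℕ} [Fact p.Prime], p ≠ 2 →
      wasserstein n (quadraticResidueMeasure p) (volume : Measure UnitAddCircle) ≤
        ENNReal.ofReal (C / √(p : ℝ)) := by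
  obtain ⟨K, hK0, hK⟩ := exists_moment_bound hn
  -- The outer `2` bounds `p` times an arc length; `2 * K ^ n` comes from the moments of `s i` and
  -- `s (i + 1)`, and `1` from the additive constant in the displacement.
  set A : ℝ := 2 * (2 * K ^ n + 1) with hA
  have hA1 : 1 ≤ A := by
    have : 0 < K ^ n := by positivity
    linarith
  refine ⟨4 * A, by linarith, fun {p} _ hp => ?_⟩
  obtain ⟨s, hs, hs0⟩ := exists_mean_zero_partial_sums hp
  have hmono := monotone_arcEnd_natCast hs
  have hp0 := cast_prime_pos p
  have hp1 : (1 : ℝ) ≤ √p := by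
    rw [Real.one_le_sqrt]
    exact_mod_cast (Fact.out : p.Prime).one_le
  have h := wasserstein_natCast_le_of_arcs hmono (fun i => ZMod.toAddCircle (i : ZMod p))
      arcEnd_prime (m := n) (by lia)
  rw [← quadraticResidueMeasure_eq_sum_arcEnd hs hp] at h
  refine h.trans (ENNReal.ofReal_le_ofReal ?_)
  have hpow : ∀ a b : ℝ, 0 ≤ a → 0 ≤ b → (a + b + 1) ^ n ≤ 4 ^ n * (a ^ n + b ^ n + 1) := by
    intro a b ha hb
    have h1 := add_pow_le (add_nonneg ha hb) zero_le_one n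
    have h2 := add_pow_le ha hb n
    have h3 : (2 : ℝ) ^ (n - 1) ≤ 2 ^ n := pow_le_pow_right₀ one_le_two (Nat.sub_le _ _)
    have h4 : (1 : ℝ) ≤ 2 ^ n := one_le_pow₀ one_le_two
    have h5 : (4 : ℝ) ^ n = 2 ^ n * 2 ^ n := by rw [← mul_pow]; norm_num
    calc (a + b + 1) ^ n ≤ 2 ^ (n - 1) * ((a + b) ^ n + 1 ^ n) := h1
      _ ≤ 2 ^ n * (2 ^ n * (a ^ n + b ^ n) + 2 ^ n * 1) := by
          rw [one_pow, mul_one]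
          gcongr
          exact h2.trans (by gcongr)
      _ = _ := by rw [h5]; ring
  have hcell : ∀ i : ℕ, ∫ y in (arcEnd s (i : ℤ))..(arcEnd s ((i + 1 : ℕ) : ℤ)),
      dist (ZMod.toAddCircle (i : ZMod p)) (y : UnitAddCircle) ^ n ≤
        2 / p * (4 ^ n * (|s i| ^ n + |s (i + 1)| ^ n + 1) / p ^ n) := by
    intro i
    have hle := hmono i.le_succ
    have hwidth : arcEnd s ((i + 1 : ℕ) : ℤ) - arcEnd s (i : ℤ) ≤ 2 / p := by
      rw [Nat.cast_succ, arcEnd_add_one_sub hs]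
      gcongr
      linarith [(neg_one_le_quadraticChar ((i : ℤ) : ZMod p)).2]
    calc _ ≤ ∫ y in (arcEnd s (i : ℤ))..(arcEnd s ((i + 1 : ℕ) : ℤ)),
          ((|s i| + |s (i + 1)| + 1) / p) ^ n := by
          refine intervalIntegral.integral_mono_on hle ?_ (by simp) fun y hy => ?_
          · have hc : Continuous fun u : UnitAddCircle =>
              dist (ZMod.toAddCircle (i : ZMod p)) u ^ n := by fun_prop
            exact (hc.comp (AddCircle.continuous_mk' 1)).intervalIntegrable _ _
          · gcongr
            exact (dist_toAddCircle_natCast_le i y).trans (abs_sub_le_of_mem_arc hy)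
      _ = (arcEnd s ((i + 1 : ℕ) : ℤ) - arcEnd s (i : ℤ)) *
          ((|s i| + |s (i + 1)| + 1) / p) ^ n := by
          rw [intervalIntegral.integral_const, smul_eq_mul]
      _ ≤ 2 / p * ((|s i| + |s (i + 1)| + 1) / p) ^ n := by gcongr
      _ ≤ _ := by
          rw [div_pow]
          gcongr
          exact hpow _ _ (abs_nonneg _) (abs_nonneg _)
  have hsum : ∑ i ∈ Finset.range p, ∫ y in (arcEnd s (i : ℤ))..(arcEnd s ((i + 1 : ℕ) : ℤ)),
      dist (ZMod.toAddCircle (i : ZMod p)) (y : UnitAddCircle) ^ n ≤ (4 * A / √p) ^ n := by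
    refine (Finset.sum_le_sum fun i _ => hcell i).trans ?_
    rw [← ZMod.sum_eq_sum_range p fun z =>
      2 / (p : ℝ) * (4 ^ n * (|s z| ^ n + |s (z + 1)| ^ n + 1) / p ^ n), ← Finset.mul_sum,
      ← Finset.sum_div, ← Finset.mul_sum, Finset.sum_add_distrib, Finset.sum_add_distrib,
      Fintype.sum_bijective (fun z : ZMod p => z + 1)
        (AddGroup.addRight_bijective 1) _ (fun z => |s z| ^ n) fun z => rfl]
    have hm := hK hp hs hs0
    have hpn : (1 : ℝ) ≤ √p ^ n := one_le_pow₀ hp1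
    have hpp : (p : ℝ) ^ n = √p ^ n * √p ^ n := by
      rw [← mul_pow, Real.mul_self_sqrt hp0.le]
    have hone : ∑ _z : ZMod p, (1 : ℝ) = p := by simp [ZMod.card]
    calc 2 / (p : ℝ) * (4 ^ n * (∑ z, |s z| ^ n + ∑ z, |s z| ^ n + ∑ _z : ZMod p, (1 : ℝ)) / p ^ n)
        ≤ 2 / (p : ℝ) * (4 ^ n * (p * (K * √p) ^ n + p * (K * √p) ^ n + p * √p ^ n) / p ^ n) := by
          gcongr
          rw [hone]
          exact le_mul_of_one_le_right hp0.le hpn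
      _ = 4 ^ n * A / √p ^ n := by
          rw [hpp, hA, mul_pow]
          field_simp
          ring
      _ ≤ 4 ^ n * A ^ n / √p ^ n := by
          gcongr
          exact le_self_pow₀ hA1 (by lia)
      _ = _ := by rw [div_pow, mul_pow 4 A]
  have hnn : 0 ≤ ∑ i ∈ Finset.range p, ∫ y in (arcEnd s (i : ℤ))..(arcEnd s ((i + 1 : ℕ) : ℤ)),
      dist (ZMod.toAddCircle (i : ZMod p)) (y : UnitAddCircle) ^ n :=
    Finset.sum_nonneg fun i _ => intervalIntegral.integral_nonneg (hmono i.le_succ)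
      fun y _ => by positivity
  calc _ ≤ ((4 * A / √p) ^ n) ^ (n : ℝ)⁻¹ := Real.rpow_le_rpow hnn hsum (by positivity)
    _ = _ := Real.pow_rpow_inv_natCast (by positivity) (by lia)

theorem wasserstein_top_quadraticResidueMeasure_le (hp : p ≠ 2) :
    wasserstein ∞ (quadraticResidueMeasure p) (volume : Measure UnitAddCircle) ≤
      ENNReal.ofReal (5 / Real.log 2 * Real.log p / √(p : ℝ)) := by
  obtain ⟨s, hs, hs0⟩ := exists_mean_zero_partial_sums hp
  have hp0 := cast_prime_pos p
  have hlog : 0 < Real.log 2 := Real.log_pos one_lt_two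
  have hlogp : Real.log 2 ≤ Real.log p :=
    Real.log_le_log two_pos (by exact_mod_cast (Fact.out : p.Prime).two_le)
  have hp1 : (1 : ℝ) ≤ √p := by
    rw [Real.one_le_sqrt]
    exact_mod_cast (Fact.out : p.Prime).one_le
  -- This absorbs the additive `1` of the displacement, so the constant is `5 = 2 + 2 + 1`.
  have hone : 1 ≤ 1 / Real.log 2 * (√p * Real.log p) := by
    rw [one_div, ← div_eq_inv_mul, one_le_div hlog]
    nlinarith
  have hb := abs_le_sqrt_mul_log hp hs hs0
  rw [quadraticResidueMeasure_eq_sum_arcEnd hs hp]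
  refine wasserstein_le_of_arcs (monotone_arcEnd_natCast hs) _ arcEnd_prime fun i _ y hy => ?_
  refine ((dist_toAddCircle_natCast_le i y).trans
    (abs_sub_le_of_mem_arc (Set.Ioc_subset_Icc_self hy))).trans ?_
  calc (|s i| + |s (i + 1)| + 1) / p
      ≤ (2 / Real.log 2 * (√p * Real.log p) + 2 / Real.log 2 * (√p * Real.log p) +
          1 / Real.log 2 * (√p * Real.log p)) / p := by
        gcongr
        · exact hb _
        · exact hb _
    _ = 5 / Real.log 2 * Real.log p * √p / (√p * √p) := by
        rw [Real.mul_self_sqrt hp0.le]; ring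
    _ = _ := mul_div_mul_right _ _ (by positivity)

/-- The character argument needs `p` odd; for `p = 2` the diameter `1/2` of the circle suffices. -/
theorem wasserstein_quadraticResidueMeasure_two_le (r : ℝ≥0∞) :
    wasserstein r (quadraticResidueMeasure 2) (volume : Measure UnitAddCircle) ≤
      ENNReal.ofReal (1 / √2) := by
  have : IsProbabilityMeasure (quadraticResidueMeasure 2) :=
    isProbabilityMeasure_empiricalMeasure _ two_ne_zero
  have hvol : IsProbabilityMeasure (volume : Measure UnitAddCircle) := ⟨by simp⟩
  refine wasserstein_le_of_dist_le (fun x y => ?_) _ _ _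
  rw [dist_eq_norm]
  refine (AddCircle.norm_le_half_period 1 one_ne_zero).trans ?_
  rw [abs_one]
  refine one_div_le_one_div_of_le (by positivity) ?_
  rw [Real.sqrt_le_left] <;> norm_num

end Main

theorem mainTheorem4 :
    -- the bound for finite exponents, with a constant depending only on the exponent
    (∀ r : ℝ≥0∞, 1 ≤ r → r ≠ ∞ → ∃ C : ℝ, 0 < C ∧ ∀ p : ℕ, p.Prime →
      wasserstein r (quadraticResidueMeasure p) (volume : Measure UnitAddCircle) ≤
        ENNReal.ofReal (C / √(p : ℝ))) ∧
    -- the bound for the exponent `∞`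
    (∃ C : ℝ, 0 < C ∧ ∀ p : ℕ, p.Prime →
      wasserstein ∞ (quadraticResidueMeasure p) (volume : Measure UnitAddCircle) ≤
        ENNReal.ofReal (C * Real.log (p : ℝ) / √(p : ℝ))) ∧
    -- the exact value for the exponent `2`
    (∀ p : ℕ, p.Prime → p ≠ 2 →
      wasserstein 2 (quadraticResidueMeasure p) (volume : Measure UnitAddCircle) =
        ENNReal.ofReal √(((p : ℝ) ^ 2 + (p : ℝ) - 1) / (12 * (p : ℝ) ^ 3))) ∧
    -- tightness of the first bound for every finite exponent at least `2`
    (∀ r : ℝ≥0∞, 2 ≤ r → r ≠ ∞ → ∀ p : ℕ, p.Prime → p ≠ 2 →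
      ENNReal.ofReal (1 / √(12 * (p : ℝ))) ≤
        wasserstein r (quadraticResidueMeasure p) (volume : Measure UnitAddCircle)) := by
  refine ⟨fun r _ hr => ?_, ?_, fun p hp hp2 => ?_, fun r hr _ p hp hp2 => ?_⟩
  -- Monotonicity in the exponent reduces `r` to an integer exponent at least 2.
  · obtain ⟨N, hN⟩ := ENNReal.exists_nat_gt hr
    obtain ⟨C, hC1, hC⟩ := exists_wasserstein_natCast_le (n := N + 2) (by lia)
    refine ⟨C, by linarith, fun p hp => ?_⟩
    have : Fact p.Prime := ⟨hp⟩
    by_cases hp2 : p = 2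
    · subst hp2
      refine (wasserstein_quadraticResidueMeasure_two_le r).trans (ENNReal.ofReal_le_ofReal ?_)
      rw [Nat.cast_ofNat]
      gcongr
    · refine (wasserstein_mono_exponent ?_ _ _).trans (hC hp2)
      exact hN.le.trans (by exact_mod_cast Nat.le_add_right N 2)
  · have hlog : 0 < Real.log 2 := Real.log_pos one_lt_two
    refine ⟨5 / Real.log 2, by positivity, fun p hp => ?_⟩
    have : Fact p.Prime := ⟨hp⟩
    by_cases hp2 : p = 2
    · subst hp2
      refine (wasserstein_quadraticResidueMeasure_two_le ∞).trans (ENNReal.ofReal_le_ofReal ?_)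
      rw [Nat.cast_ofNat, div_mul_cancel₀ _ hlog.ne']
      gcongr
      norm_num
    · exact wasserstein_top_quadraticResidueMeasure_le hp2
  · have : Fact p.Prime := ⟨hp⟩
    exact wasserstein_two_quadraticResidueMeasure hp2
  · have : Fact p.Prime := ⟨hp⟩
    refine le_trans ?_ (wasserstein_mono_exponent hr _ _)
    rw [wasserstein_two_quadraticResidueMeasure hp2]
    refine ENNReal.ofReal_le_ofReal ?_
    rw [one_div, ← Real.sqrt_inv]
    refine Real.sqrt_le_sqrt ?_
    have hp0 := cast_prime_pos p
    have hp1 : (1 : ℝ) ≤ p := by exact_mod_cast hp.one_le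
    -- The claim amounts to `p² ≤ p² + p - 1`.
    rw [inv_eq_one_div, div_le_div_iff₀ (by positivity) (by positivity)]
    nlinarith [mul_nonneg hp0.le (sub_nonneg.2 hp1)]
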